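/- Let $\{r_n\}_{n\ge0}$, $\{q_n\}_{n\ge0}$ be real sequences with $r_n>0$ for all $n\ge 0$, let $\{\sigma_n\}_{n\ge0}$ be a complex sequence, and put $\Delta a_n=a_{n+1}-a_n$. Consider the equations $$(1)\quad \Delta(r_{n-1}\Delta y_{n-1})=(q_n+\sigma_n)y_n,\qquad (2)\quad \Delta(r_{n-1}\Delta z_{n-1})=q_nz_n,\qquad n\ge 1,$$ for sequences indexed by $n=0,1,2,\dots$. Let $\{u_n,v_n\}_{n\ge0}$ be a real fundamental system of solutions of (2) such that, for all $n\ge0$, $u_n>0$, $v_n>0$ and $r_n(v_{n+1}u_n-u_{n+1}v_n)=1$, and such that $$\lim_{n\to\infty}\frac{u_n}{v_n}=0,\qquad \sum_{n=0}^\infty\frac1{r_nu_nu_{n+1}}=\infty,\qquad \sum_{n=0}^\infty\frac1{r_nv_nv_{n+1}}<\infty .$$ The narrow Hartman–Wintner problem is called solvable if (1) has a fundamental system of (complex) solutions $\{\tilde u_n,\tilde v_n\}_{n\ge0}$ (two linearly independent solutions) such that, as $n\to\infty$, $$\frac{\tilde u_n}{u_n}\to1,\quad \frac{\tilde v_n}{v_n}\to1,\quad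 \frac{\tilde u_{n+1}}{\tilde u_n}=\frac{u_{n+1}}{u_n}+o\Big(\frac1{r_nu_nv_n}\Big),\quad \frac{\tilde v_{n+1}}{\tilde v_n}=\frac{v_{n+1}}{v_n}+o\Big(\frac1{r_nu_nv_n}\Big),$$ and $$\sum_{n=0}^\infty r_nu_nv_{n+1}\Big|\frac{\tilde u_{n+1}}{u_{n+1}}-\frac{\tilde u_n}{u_n}\Big|^2<\infty .$$ Suppose that the series $J=\sum_{n=0}^\infty\sigma_nu_nv_n$ converges (at least conditionally). Put $$J_m=\sum_{k=m}^\infty\sigma_ku_kv_k,\qquad A_n=\sup_{m\ge n}|J_m|,\qquad C_n=\frac{v_n}{u_n}\sum_{k=n}^\infty\sigma_ku_k^2$$ (the last series then converges, at least conditionally). Then the narrow Hartman–Wintner problem is solvable if any one of the following conditions holds: (I) at least one of the following inequalities holds: $$\sum_{n=0}^\infty\frac{|J_{n+1}C_{n+1}|}{r_nu_nv_{n+1}}<\infty,\qquad \sum_{n=0}^\infty\frac{A_{n+1}|C_{n+1}|}{r_nv_{n+1}u_n}<\infty,\qquad \sum_{n=0}^\infty\frac{|J_{n+1}|^2}{r_nu_nv_{n+1}}<\infty;$$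 (II) the series $P=\sum_{n=0}^\infty\operatorname{Re}(\sigma_n\overline{C_n})\,u_nv_n$ converges (at least conditionally); (III) $\sum_{n=0}^\infty|\sigma_n|A_nu_nv_n<\infty$; (IV) the series $J$ converges absolutely. -/

import Mathlib

open Filter Topology Asymptotics

noncomputable section

namespace HartmanWintner

/-- The forward difference `Δ a` of a sequence. -/
def fdiff (a : ℕ → ℂ) (n : ℕ) : ℂ := a (n + 1) - a n

/-- `y` solves `Δ(r_{n-1} Δ y_{n-1}) = p_n y_n`. For a sequence indexed by `n = 0, 1, 2, …` the
equation makes sense for `n ≥ 1`; here `n` is replaced by `n + 1`. (The instance `n = 0` would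
only define a value `y_{-1}`.) -/
def IsSolution (r : ℕ → ℝ) (p : ℕ → ℂ) (y : ℕ → ℂ) : Prop :=
  ∀ n, fdiff (fun k => (r k : ℂ) * fdiff y k) n = p (n + 1) * y (n + 1)

/-- A fundamental system of solutions: two linearly independent solutions. -/
def IsFSS (r : ℕ → ℝ) (p : ℕ → ℂ) (y z : ℕ → ℂ) : Prop :=
  IsSolution r p y ∧ IsSolution r p z ∧ LinearIndependent ℂ ![y, z]

/-- `u` is a principal and `v` a non-principal solution of the unperturbed real equation
`Δ(r_{n-1} Δ z_{n-1}) = q_n z_n`, both positive and normalized by their Casoratian. -/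
structure IsPrincipalPair (r q u v : ℕ → ℝ) : Prop where
  fss : IsFSS r (fun n => (q n : ℂ)) (fun n => (u n : ℂ)) (fun n => (v n : ℂ))
  u_pos : ∀ n, 0 < u n
  v_pos : ∀ n, 0 < v n
  casoratian : ∀ n, r n * (v (n + 1) * u n - u (n + 1) * v n) = 1
  ratio_tendsto : Tendsto (fun n => u n / v n) atTop (𝓝 0)
  u_diverges : ¬ Summable fun n => 1 / (r n * u n * u (n + 1))
  v_converges : Summable fun n => 1 / (r n * v n * v (n + 1))

/-- `{u', v'}` is a solution of the Hartman–Wintner problem for the perturbation `σ`. -/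
structure IsHWSolution (r q : ℕ → ℝ) (σ : ℕ → ℂ) (u v : ℕ → ℝ) (u' v' : ℕ → ℂ) : Prop where
  fss : IsFSS r (fun n => (q n : ℂ) + σ n) u' v'
  u_ratio : Tendsto (fun n => u' n / (u n : ℂ)) atTop (𝓝 1)
  v_ratio : Tendsto (fun n => v' n / (v n : ℂ)) atTop (𝓝 1)
  u_step : (fun n => u' (n + 1) / u' n - ((u (n + 1) / u n : ℝ) : ℂ))
    =o[atTop] (fun n => 1 / (r n * u n * v n))
  v_step : (fun n => v' (n + 1) / v' n - ((v (n + 1) / v n : ℝ) : ℂ))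
    =o[atTop] (fun n => 1 / (r n * u n * v n))

/-- The narrow Hartman–Wintner problem is solvable. -/
def NarrowSolvable (r q : ℕ → ℝ) (σ : ℕ → ℂ) (u v : ℕ → ℝ) : Prop :=
  ∃ u' v' : ℕ → ℂ, IsHWSolution r q σ u v u' v' ∧
    Summable fun n =>
      r n * u n * v (n + 1) * ‖u' (n + 1) / (u (n + 1) : ℂ) - u' n / (u n : ℂ)‖ ^ 2

/-- The series `∑_{n ≥ 0} a_n` converges, at least conditionally: its partial sums, taken in the
natural order, have a limit. -/
def SeriesConverges {E : Type*} [NormedAddCommGroup E] (a : ℕ → E) : Prop :=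
  ∃ s : E, Tendsto (fun N => ∑ n ∈ Finset.range N, a n) atTop (𝓝 s)

/-- The (possibly conditionally convergent) tail `∑_{k = m}^∞ a_k`. -/
def tailSum (a : ℕ → ℂ) (m : ℕ) : ℂ :=
  limUnder atTop fun N => ∑ k ∈ Finset.Ico m N, a k

/-- The terms `σ_n u_n v_n` of the series `J`. -/
def termJ (σ : ℕ → ℂ) (u v : ℕ → ℝ) (n : ℕ) : ℂ := σ n * (u n : ℂ) * (v n : ℂ)

/-- `J_m = ∑_{k ≥ m} σ_k u_k v_k`. -/
def tailJ (σ : ℕ → ℂ) (u v : ℕ → ℝ) (m : ℕ) : ℂ := tailSum (termJ σ u v) m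

/-- `A_n = sup_{m ≥ n} |J_m|`. -/
def supJ (σ : ℕ → ℂ) (u v : ℕ → ℝ) (n : ℕ) : ℝ := ⨆ k : ℕ, ‖tailJ σ u v (n + k)‖

/-- `C_n = (v_n / u_n) ∑_{k ≥ n} σ_k u_k ^ 2`. -/
def seqC (σ : ℕ → ℂ) (u v : ℕ → ℝ) (n : ℕ) : ℂ :=
  ((v n / u n : ℝ) : ℂ) * tailSum (fun k => σ k * (u k : ℂ) ^ 2) n

/-- The terms `Re (σ_n conj(C_n)) u_n v_n` of the series `P`. -/
def termP (σ : ℕ → ℂ) (u v : ℕ → ℝ) (n : ℕ) : ℝ :=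
  (σ n * (starRingEnd ℂ) (seqC σ u v n)).re * u n * v n

end HartmanWintner

end

noncomputable section

namespace HartmanWintner

/-! Put `w = v / u`, which increases to infinity. The substitution `y = u f` turns the perturbed
equation into the system `Δf = Δw · D`, `ΔD n = s (n + 1) * f (n + 1)` with `s = σ u²`, whose
unperturbed solutions are `1` and `w`. With `S` the tails of `∑ s`, so that `C = w S`, the problem
is solvable once `w S → 0`, `∑ S (n + 1) Δw` converges and `∑ w (n + 1) |S (n + 1)|² Δw < ∞`
(`narrowSolvable_of_tails`).

Under these conditions the quantity `D n + S (n + 1) * f n` replaces the rough coefficient `s` by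
`S` and `S²`. Integrating factors, which converge by `exists_product_tendsto_one`, remove the
diagonal terms, and a Volterra equation at infinity gives the solution near `1`
(`exists_principal_asymptotics`). Reduction of order gives the one near `w`.

Convergence of `J` yields the first two conditions by Abel summation (`exists_weighted_tails`). The
quadratic condition is where (I)–(IV) enter: `weight_mul_sq_le` and `weight_mul_sq_le_of_re` bound
its terms, up to telescoping squares, by those of the first series in (I) and of `P`. The other
alternatives reduce to these or to the same inequalities. -/

/-- A nonnegative series is summable if its terms are dominated, up to a telescoping term, by
a series with bounded partial sums. -/
theorem summable_of_le_add_telescoping {f g h : ℕ → ℝ} {B H : ℝ} (hf : ∀ n, 0 ≤ f n)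
    (hfg : ∀ n, f n ≤ g n + (h (n + 1) - h n))
    (hg : ∀ n, ∑ i ∈ Finset.range n, g i ≤ B) (hh : ∀ n, h n ≤ H) : Summable f := by
  refine summable_of_sum_range_le (c := B + (H - h 0)) hf fun n => ?_
  calc ∑ i ∈ Finset.range n, f i
      ≤ ∑ i ∈ Finset.range n, (g i + (h (i + 1) - h i)) := Finset.sum_le_sum fun i _ => hfg i
    _ = ∑ i ∈ Finset.range n, g i + (h n - h 0) := by
        rw [Finset.sum_add_distrib, Finset.sum_range_sub]
    _ ≤ B + (H - h 0) := by linarith [hg n, hh n]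

/-- A function that is eventually a null sequence times `g` is `o(g)`. -/
theorem isLittleO_of_eventuallyEq_mul {f φ : ℕ → ℂ} {g : ℕ → ℝ}
    (h : ∀ᶠ n in atTop, f n = φ n * (g n : ℂ)) (hφ : Tendsto φ atTop (𝓝 0)) :
    f =o[atTop] g := by
  rw [isLittleO_iff]
  intro c hc
  filter_upwards [h, (tendsto_zero_iff_norm_tendsto_zero.1 hφ).eventually (gt_mem_nhds hc)]
    with n hn hcn
  rw [hn, norm_mul, Complex.norm_real]
  exact mul_le_mul_of_nonneg_right hcn.le (norm_nonneg _)

/-! ### Tails of unconditionally convergent series. -/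

/-- The tail of an unconditionally convergent series. -/
def tsumTail {E : Type*} [NormedAddCommGroup E] (f : ℕ → E) (n : ℕ) : E := ∑' k, f (k + n)

section tsumTail

variable {E : Type*} [NormedAddCommGroup E]

theorem tendsto_tsumTail (f : ℕ → E) : Tendsto (tsumTail f) atTop (𝓝 0) :=
  tendsto_sum_nat_add f

theorem tsumTail_eq_add_succ {f : ℕ → E} (hf : Summable f) (n : ℕ) :
    tsumTail f n = f n + tsumTail f (n + 1) := by
  have := ((summable_nat_add_iff n).2 hf).tsum_eq_zero_add
  simp only [tsumTail]
  rw [this, zero_add]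
  congr 1
  exact tsum_congr fun k => by rw [add_assoc, add_comm 1 n]

theorem norm_tsumTail_le {f : ℕ → E} {g : ℕ → ℝ} {n : ℕ} (hg : Summable g)
    (hfg : ∀ k, n ≤ k → ‖f k‖ ≤ g k) : ‖tsumTail f n‖ ≤ tsumTail g n :=
  tsum_of_norm_bounded ((summable_nat_add_iff n).2 hg).hasSum fun k =>
    hfg _ (Nat.le_add_left n k)

theorem tsumTail_sub {f g : ℕ → E} (hf : Summable f) (hg : Summable g) (n : ℕ) :
    tsumTail f n - tsumTail g n = tsumTail (fun k => f k - g k) n :=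
  (((summable_nat_add_iff n).2 hf).tsum_sub ((summable_nat_add_iff n).2 hg)).symm

theorem tsumTail_nonneg {g : ℕ → ℝ} (hg : ∀ n, 0 ≤ g n) (n : ℕ) : 0 ≤ tsumTail g n :=
  tsum_nonneg fun _ => hg _

theorem tsumTail_const_mul (c : ℝ) (g : ℕ → ℝ) (n : ℕ) :
    tsumTail (fun k => c * g k) n = c * tsumTail g n := tsum_mul_left

theorem tsumTail_le_tsum {g : ℕ → ℝ} (hg : ∀ n, 0 ≤ g n) (hs : Summable g) (n : ℕ) :
    tsumTail g n ≤ ∑' k, g k := by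
  rw [← hs.sum_add_tsum_nat_add n]
  exact le_add_of_nonneg_left (Finset.sum_nonneg fun i _ => hg i)

end tsumTail

/-! ### Infinite products and Volterra equations at infinity. -/

/-- If `∑ x` converges conditionally and `∑ |x|²` converges, then the recursion
`α (n + 1) = (1 + x n) α n` has an eventual solution tending to `1`. -/
theorem exists_product_tendsto_one {x : ℕ → ℂ}
    (hx : SeriesConverges x) (hx2 : Summable fun n => ‖x n‖ ^ 2) :
    ∃ α : ℕ → ℂ, (∀ n, α n ≠ 0) ∧ Tendsto α atTop (𝓝 1) ∧
      ∀ᶠ n in atTop, α (n + 1) = (1 + x n) * α n := by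
  have hsmall : ∀ᶠ n in atTop, ‖x n‖ < 1 / 2 := by
    filter_upwards [hx2.tendsto_atTop_zero.eventually
      (gt_mem_nhds (by norm_num : (0 : ℝ) < (1 / 2) ^ 2))] with n hn
    exact lt_of_pow_lt_pow_left₀ 2 (by norm_num) hn
  -- The difference is `O(|x|²)`, so `∑ log (1 + x)` inherits the conditional convergence of `∑ x`.
  have hlog : Summable fun n => Complex.log (1 + x n) - x n := by
    refine Summable.of_norm_bounded_eventually_nat hx2 ?_
    filter_upwards [hsmall] with n hn
    refine (Complex.norm_log_one_add_sub_self_le (by linarith)).trans ?_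
    have : (1 - ‖x n‖)⁻¹ ≤ 2 := by
      rw [inv_le_comm₀ (by linarith) (by norm_num)]; linarith
    nlinarith [sq_nonneg ‖x n‖]
  obtain ⟨s, hs⟩ := hx
  obtain ⟨l, hl⟩ : ∃ l, Tendsto (fun N => ∑ n ∈ Finset.range N, Complex.log (1 + x n))
      atTop (𝓝 l) := by
    refine ⟨_, (hlog.hasSum.tendsto_sum_nat.add hs).congr fun N => ?_⟩
    rw [← Finset.sum_add_distrib]
    exact Finset.sum_congr rfl fun n _ => by ring
  -- Subtracting `l` normalizes the limit to `1`. The exponential never vanishes, even if some early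
  -- `1 + x n` does; hence the recursion is only eventual.
  refine ⟨fun N => Complex.exp (∑ n ∈ Finset.range N, Complex.log (1 + x n) - l),
    fun n => Complex.exp_ne_zero _, ?_, ?_⟩
  · have := (Complex.continuous_exp.tendsto (l - l)).comp (hl.sub_const l)
    rwa [sub_self, Complex.exp_zero] at this
  · filter_upwards [hsmall] with n hn
    have h0 : 1 + x n ≠ 0 := by
      intro h
      have : x n = -1 := by linear_combination h
      rw [this] at hn
      norm_num at hn
    rw [Finset.sum_range_succ, add_sub_right_comm, Complex.exp_add, Complex.exp_log h0, mul_comm]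

/-- A linear Volterra equation "at infinity" with small kernel has a bounded solution. -/
theorem exists_bounded_fixed_point {P κ : ℕ → ℂ} (hκ : Summable fun n => ‖κ n‖)
    (hP : Summable fun n => ‖P n‖ * tsumTail (fun k => ‖κ k‖) n)
    (hhalf : ∑' n, ‖P n‖ * tsumTail (fun k => ‖κ k‖) n ≤ 1 / 2) :
    ∃ (a : ℕ → ℂ) (M : ℝ), (∀ n, ‖a n‖ ≤ M) ∧
      ∀ n, a n = 1 - tsumTail (fun k => P k * tsumTail (fun j => κ j * a j) k) n := by
  set K : (ℕ → ℂ) → ℕ → ℂ :=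
    fun a n => tsumTail (fun k => P k * tsumTail (fun j => κ j * a j) k) n with hK
  have hin : ∀ {a : ℕ → ℂ} {M : ℝ}, (∀ n, ‖a n‖ ≤ M) → ∀ k,
      ‖P k * tsumTail (fun j => κ j * a j) k‖ ≤
        M * (‖P k‖ * tsumTail (fun k => ‖κ k‖) k) := by
    intro a M ha k
    rw [norm_mul, mul_left_comm, ← tsumTail_const_mul]
    refine mul_le_mul_of_nonneg_left (norm_tsumTail_le (hκ.mul_left M) fun j _ => ?_)
      (norm_nonneg _)
    rw [norm_mul, mul_comm]
    exact mul_le_mul_of_nonneg_right (ha j) (norm_nonneg _)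
  have hsum : ∀ {a : ℕ → ℂ} {M : ℝ}, (∀ n, ‖a n‖ ≤ M) →
      Summable fun k => P k * tsumTail (fun j => κ j * a j) k := fun ha =>
    Summable.of_norm_bounded (hP.mul_left _) (hin ha)
  have hsum' : ∀ {a : ℕ → ℂ} {M : ℝ}, (∀ n, ‖a n‖ ≤ M) →
      Summable fun k => κ k * a k := by
    intro a M ha
    refine Summable.of_norm_bounded (hκ.mul_left M) fun j => ?_
    rw [norm_mul, mul_comm]
    exact mul_le_mul_of_nonneg_right (ha j) (norm_nonneg _)
  -- The operator `K` halves sup bounds; being linear, it makes `a ↦ 1 - K a` a contraction of the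
  -- bounded sequences.
  have hbound : ∀ {a : ℕ → ℂ} {M : ℝ}, 0 ≤ M → (∀ n, ‖a n‖ ≤ M) → ∀ n,
      ‖K a n‖ ≤ M * (1 / 2) := by
    intro a M hM ha n
    refine (norm_tsumTail_le (hP.mul_left M) fun k _ => hin ha k).trans ?_
    rw [tsumTail_const_mul]
    refine mul_le_mul_of_nonneg_left ((tsumTail_le_tsum (fun k => ?_) hP n).trans hhalf) hM
    exact mul_nonneg (norm_nonneg _) (tsumTail_nonneg (fun _ => norm_nonneg _) _)
  have hsub : ∀ a b : BoundedContinuousFunction ℕ ℂ, ∀ n, K a n - K b n = K (a - b) n := by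
    intro a b n
    simp only [hK]
    rw [tsumTail_sub (hsum a.norm_coe_le_norm) (hsum b.norm_coe_le_norm)]
    congr 1
    funext k
    rw [← mul_sub, tsumTail_sub (hsum' a.norm_coe_le_norm) (hsum' b.norm_coe_le_norm)]
    simp [mul_sub]
  set T : BoundedContinuousFunction ℕ ℂ → BoundedContinuousFunction ℕ ℂ := fun a =>
    BoundedContinuousFunction.ofNormedAddCommGroupDiscrete (fun n => 1 - K a n)
      (1 + ‖a‖ * (1 / 2)) (fun n => (norm_sub_le _ _).trans (by
        rw [norm_one]
        exact add_le_add_right (hbound (norm_nonneg a) a.norm_coe_le_norm n) 1)) with hT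
  have hc : ContractingWith (1 / 2) T := by
    refine ⟨by rw [← NNReal.coe_lt_coe]; norm_num, LipschitzWith.of_dist_le_mul fun a b => ?_⟩
    rw [BoundedContinuousFunction.dist_le (by positivity)]
    intro n
    have h1 : dist (T a n) (T b n) = ‖K (a - b) n‖ := by
      rw [dist_comm, dist_eq_norm, ← hsub]
      congr 1
      simp only [hT, BoundedContinuousFunction.coe_ofNormedAddCommGroupDiscrete]
      ring
    rw [h1, dist_eq_norm, mul_comm]
    have := hbound (norm_nonneg (a - b)) (a - b).norm_coe_le_norm n
    simpa using this
  have hfix := hc.fixedPoint_isFixedPt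
  refine ⟨_, _, (ContractingWith.fixedPoint T hc).norm_coe_le_norm, fun n => ?_⟩
  exact (DFunLike.congr_fun hfix n).symm

/-- A first-order linear system with off-diagonal coefficients `P` and `-κ` has a solution whose
first component tends to `1` and whose second component is `o(1 / w)`, if `P` is dominated by the
increments of `w` and `∑ w |κ|` converges. -/
theorem exists_asymptotic_solution {w : ℕ → ℝ} {P κ : ℕ → ℂ} {B : ℝ}
    (hw : ∀ n, 0 < w n) (hmono : Monotone w)
    (hP : ∀ᶠ n in atTop, ‖P n‖ ≤ B * (w (n + 1) - w n))
    (hκ : Summable fun n => w (n + 1) * ‖κ n‖) :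
    ∃ a F : ℕ → ℂ, Tendsto a atTop (𝓝 1) ∧
      Tendsto (fun n => w (n + 1) * ‖F n‖) atTop (𝓝 0) ∧
      (Summable fun n => (w (n + 1) - w n) * ‖F n‖) ∧
      ∀ᶠ n in atTop, a (n + 1) = a n + P n * F n ∧ F (n + 1) = F n - κ n * a n := by
  have hκ' : Summable fun n => ‖κ n‖ := by
    refine Summable.of_nonneg_of_le (fun _ => norm_nonneg _) (fun n => ?_)
      (hκ.mul_left (w 0)⁻¹)
    rw [← mul_assoc, inv_mul_eq_div]
    refine le_mul_of_one_le_left (norm_nonneg _) ((one_le_div (hw 0)).2 (hmono (Nat.zero_le _)))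
  obtain ⟨h, hh⟩ : ∃ h : ℕ → ℝ, h = tsumTail fun k => ‖κ k‖ := ⟨_, rfl⟩
  have hh0 : ∀ n, 0 ≤ h n := by
    rw [hh]; exact tsumTail_nonneg fun _ => norm_nonneg _
  have hwh : ∀ n, w (n + 1) * h n ≤ tsumTail (fun k => w (k + 1) * ‖κ k‖) n := by
    intro n
    rw [hh, ← tsumTail_const_mul]
    refine Summable.tsum_le_tsum (fun k => ?_) ((summable_nat_add_iff n).2 (hκ'.mul_left _))
      ((summable_nat_add_iff n).2 hκ)
    exact mul_le_mul_of_nonneg_right (hmono (by omega)) (norm_nonneg _)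
  have hκnn : ∀ n, 0 ≤ w (n + 1) * ‖κ n‖ := fun n =>
    mul_nonneg (hw _).le (norm_nonneg _)
  -- Summation by parts: `Δw · h = w (n + 1) * ‖κ n‖ + Δ(w h)`, and `w h` is bounded.
  have hph : Summable fun n => (w (n + 1) - w n) * h n := by
    refine summable_of_le_add_telescoping (g := fun n => w (n + 1) * ‖κ n‖)
      (h := fun n => w n * h n)
      (fun n => mul_nonneg (sub_nonneg.2 (hmono n.le_succ)) (hh0 n)) (fun n => ?_)
      (fun n => hκ.sum_le_tsum _ fun i _ => hκnn i)
      (H := ∑' n, w (n + 1) * ‖κ n‖) (fun n => ?_)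
    · have : h n = ‖κ n‖ + h (n + 1) := by
        rw [hh]; exact tsumTail_eq_add_succ hκ' n
      simp only [this]
      apply le_of_eq
      ring
    · exact (mul_le_mul_of_nonneg_right (hmono n.le_succ) (hh0 n)).trans
        ((hwh n).trans (tsumTail_le_tsum hκnn hκ n))
  have htail : ∀ᶠ N in atTop, tsumTail (fun n => B * ((w (n + 1) - w n) * h n)) N < 1 / 2 :=
    (tendsto_tsumTail _).eventually (gt_mem_nhds (by norm_num))
  obtain ⟨N, hN, hPN⟩ := (htail.and (eventually_forall_ge_atTop.2 hP)).exists
  -- Cutting off the first `N` coefficients brings the kernel below `1 / 2`, at the price of the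
  -- recursion holding only from `N` on.
  set Q : ℕ → ℂ := fun n => if N ≤ n then P n else 0 with hQ
  have hQP : ∀ k, ‖Q (k + N)‖ * h (k + N) ≤ B * ((w (k + N + 1) - w (k + N)) * h (k + N)) := by
    intro k
    rw [← mul_assoc]
    refine mul_le_mul_of_nonneg_right ?_ (hh0 _)
    simpa [hQ] using hPN (k + N) (Nat.le_add_left _ _)
  have hBs : Summable fun k => B * ((w (k + N + 1) - w (k + N)) * h (k + N)) :=
    (summable_nat_add_iff (f := fun n => B * ((w (n + 1) - w n) * h n)) N).2 (hph.mul_left B)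
  have hQs' : Summable fun k => ‖Q (k + N)‖ * h (k + N) :=
    Summable.of_nonneg_of_le (fun k => mul_nonneg (norm_nonneg _) (hh0 _)) hQP hBs
  have hQs : Summable fun n => ‖Q n‖ * h n :=
    (summable_nat_add_iff (f := fun n => ‖Q n‖ * h n) N).1 hQs'
  have hhalf : ∑' n, ‖Q n‖ * h n ≤ 1 / 2 := by
    have h0 : ∑ n ∈ Finset.range N, ‖Q n‖ * h n = 0 := Finset.sum_eq_zero fun i hi => by
      simp [hQ, Finset.mem_range.1 hi]
    have h1 := hQs.sum_add_tsum_nat_add N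
    rw [h0, zero_add] at h1
    have h2 : ∑' k, ‖Q (k + N)‖ * h (k + N) ≤
        ∑' k, B * ((w (k + N + 1) - w (k + N)) * h (k + N)) :=
      Summable.tsum_le_tsum hQP hQs' hBs
    rw [← h1]
    exact h2.trans hN.le
  obtain ⟨a, M, haM, ha⟩ := exists_bounded_fixed_point (P := Q) hκ'
    (by rw [← hh]; exact hQs) (by rw [← hh]; exact hhalf)
  set F : ℕ → ℂ := tsumTail fun j => κ j * a j with hF
  have hM : 0 ≤ M := (norm_nonneg _).trans (haM 0)
  have hκa : ∀ j, ‖κ j * a j‖ ≤ M * ‖κ j‖ := fun j => by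
    rw [norm_mul, mul_comm]
    exact mul_le_mul_of_nonneg_right (haM j) (norm_nonneg _)
  have hκas : Summable fun j => κ j * a j := Summable.of_norm_bounded (hκ'.mul_left M) hκa
  have hFh : ∀ n, ‖F n‖ ≤ M * h n := fun n => by
    rw [hh, ← tsumTail_const_mul]
    exact norm_tsumTail_le (hκ'.mul_left M) fun j _ => hκa j
  have hQF : Summable fun n => Q n * F n := by
    refine Summable.of_norm_bounded (hQs.mul_left M) fun n => ?_
    rw [norm_mul, mul_left_comm]
    exact mul_le_mul_of_nonneg_left (hFh n) (norm_nonneg _)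
  refine ⟨a, F, ?_, ?_, ?_, ?_⟩
  · have := (tendsto_tsumTail fun n => Q n * F n).const_sub 1
    rw [sub_zero] at this
    exact this.congr fun n => (ha n).symm
  · refine squeeze_zero (fun n => mul_nonneg (hw _).le (norm_nonneg _)) (fun n => ?_)
      (by simpa using (tendsto_tsumTail fun k => w (k + 1) * ‖κ k‖).const_mul M)
    calc w (n + 1) * ‖F n‖ ≤ w (n + 1) * (M * h n) :=
          mul_le_mul_of_nonneg_left (hFh n) (hw _).le
      _ = M * (w (n + 1) * h n) := by ring
      _ ≤ _ := mul_le_mul_of_nonneg_left (hwh n) hM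
  · refine Summable.of_nonneg_of_le
      (fun n => mul_nonneg (sub_nonneg.2 (hmono n.le_succ)) (norm_nonneg _)) (fun n => ?_)
      (hph.mul_left M)
    rw [mul_left_comm]
    exact mul_le_mul_of_nonneg_left (hFh n) (sub_nonneg.2 (hmono n.le_succ))
  · filter_upwards [eventually_ge_atTop N] with n hn
    constructor
    · have h1 := tsumTail_eq_add_succ hQF n
      have h2 : Q n = P n := if_pos hn
      rw [ha n, ha (n + 1), h1, h2]
      ring
    · have h1 : F n = κ n * a n + F (n + 1) := tsumTail_eq_add_succ hκas n
      rw [h1]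
      ring

/-! ### The reduced equation: principal and non-principal solutions. -/

/-- The equation with unperturbed solutions `1` and `w`: if the tails `S` of `∑ s` satisfy
`w S → 0`, `∑ S Δw` converges and `∑ w |S|² Δw < ∞`, then there is a solution tending to `1`. -/
theorem exists_principal_asymptotics {w : ℕ → ℝ} {S : ℕ → ℂ}
    (hw : ∀ n, 0 < w n) (hmono : StrictMono w)
    (hS : Tendsto (fun n => w n * ‖S n‖) atTop (𝓝 0))
    (hSw : SeriesConverges fun n => ((w (n + 1) - w n : ℝ) : ℂ) * S (n + 1))
    (hS2 : Summable fun n => (w (n + 1) - w n) * w (n + 1) * ‖S (n + 1)‖ ^ 2) :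
    ∃ a D : ℕ → ℂ, Tendsto a atTop (𝓝 1) ∧
      Tendsto (fun n => (w n : ℂ) * D n) atTop (𝓝 0) ∧
      (Summable fun n => (w (n + 1) - w n) * w (n + 1) * ‖D n‖ ^ 2) ∧
      ∀ᶠ n in atTop, a (n + 1) - a n = ((w (n + 1) - w n : ℝ) : ℂ) * D n ∧
        D (n + 1) - D n = (S (n + 1) - S (n + 2)) * a (n + 1) := by
  set p : ℕ → ℝ := fun n => w (n + 1) - w n with hp
  have hp0 : ∀ n, 0 < p n := fun n => sub_pos.2 (hmono n.lt_succ_self)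
  have hpw : ∀ n, p n ≤ w (n + 1) := fun n => by simp only [hp]; linarith [hw n]
  set x : ℕ → ℂ := fun n => (p n : ℂ) * S (n + 1) with hx
  have hx2 : Summable fun n => ‖x n‖ ^ 2 := by
    refine Summable.of_nonneg_of_le (fun n => by positivity) (fun n => ?_) hS2
    rw [hx, norm_mul, Complex.norm_real, Real.norm_of_nonneg (hp0 n).le, mul_pow, sq (p n)]
    exact mul_le_mul_of_nonneg_right
      (mul_le_mul_of_nonneg_left (hpw n) (hp0 n).le) (by positivity)
  -- For a solution `A` and `E n = D n + S (n + 1) * A n` the system reads `A (n + 1) = (1 - x n) *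
  -- A n + p n * E n` and `E (n + 1) = (1 + x n) * E n - S (n + 1) ^ 2 * p n * A n`. Writing `A = α
  -- a` and `E = β F` leaves only off-diagonal coefficients.
  obtain ⟨β, hβ0, hβ1, hβ⟩ := exists_product_tendsto_one hSw hx2
  obtain ⟨α, hα0, hα1, hα⟩ := exists_product_tendsto_one (x := fun n => -x n)
    (by
      obtain ⟨l, hl⟩ := hSw
      exact ⟨-l, by simpa only [Finset.sum_neg_distrib] using hl.neg⟩)
    (by simpa using hx2)
  have hβ1' : Tendsto (fun n => β (n + 1)) atTop (𝓝 1) := (tendsto_add_atTop_iff_nat 1).2 hβ1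
  have hα1' : Tendsto (fun n => α (n + 1)) atTop (𝓝 1) := (tendsto_add_atTop_iff_nat 1).2 hα1
  have hβα : ∀ᶠ n in atTop, ‖β n / α (n + 1)‖ ≤ 2 := by
    have := (hβ1.div hα1' one_ne_zero).norm
    filter_upwards [this.eventually (gt_mem_nhds (by norm_num : ‖(1 / 1 : ℂ)‖ < 2))] with n hn
    exact hn.le
  have hαβ : ∀ᶠ n in atTop, ‖α n / β (n + 1)‖ ≤ 2 := by
    have := (hα1.div hβ1' one_ne_zero).norm
    filter_upwards [this.eventually (gt_mem_nhds (by norm_num : ‖(1 / 1 : ℂ)‖ < 2))] with n hn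
    exact hn.le
  obtain ⟨a, F, ha1, hF0, hFs, haF⟩ := exists_asymptotic_solution (w := w)
    (P := fun n => p n * (β n / α (n + 1)))
    (κ := fun n => S (n + 1) ^ 2 * p n * (α n / β (n + 1))) (B := 2) hw hmono.monotone
    (by
      filter_upwards [hβα] with n hn
      rw [norm_mul, Complex.norm_real, Real.norm_of_nonneg (hp0 n).le, mul_comm]
      exact mul_le_mul_of_nonneg_right hn (hp0 n).le)
    (by
      refine Summable.of_norm_bounded_eventually_nat (hS2.mul_left 2) ?_
      filter_upwards [hαβ] with n hn
      rw [norm_mul, norm_norm, norm_mul, norm_mul, norm_pow, Complex.norm_real,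
        Real.norm_of_nonneg (hp0 n).le, Real.norm_of_nonneg (hw _).le]
      calc w (n + 1) * (‖S (n + 1)‖ ^ 2 * p n * ‖α n / β (n + 1)‖)
          = ‖α n / β (n + 1)‖ * (p n * w (n + 1) * ‖S (n + 1)‖ ^ 2) := by ring
        _ ≤ _ := mul_le_mul_of_nonneg_right hn
          (mul_nonneg (mul_nonneg (hp0 n).le (hw _).le) (by positivity)))
  have hA1 : Tendsto (fun n => α n * a n) atTop (𝓝 1) := by simpa using hα1.mul ha1
  have hwD : Tendsto (fun n => w (n + 1) *
      ‖β n * F n - S (n + 1) * (α n * a n)‖) atTop (𝓝 0) := by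
    have h1 := (hβ1.norm.mul hF0).add
      (((tendsto_add_atTop_iff_nat 1).2 hS).mul hA1.norm)
    rw [mul_zero, zero_mul, add_zero] at h1
    refine squeeze_zero (fun n => mul_nonneg (hw _).le (norm_nonneg _)) (fun n => ?_) h1
    refine (mul_le_mul_of_nonneg_left (norm_sub_le _ _) (hw _).le).trans (le_of_eq ?_)
    simp only [norm_mul]
    ring
  refine ⟨fun n => α n * a n, fun n => β n * F n - S (n + 1) * (α n * a n), hA1, ?_, ?_, ?_⟩
  · rw [tendsto_zero_iff_norm_tendsto_zero]
    refine squeeze_zero (fun n => norm_nonneg _) (fun n => ?_) hwD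
    rw [norm_mul, Complex.norm_real, Real.norm_of_nonneg (hw n).le]
    exact mul_le_mul_of_nonneg_right (hmono.monotone n.le_succ) (norm_nonneg _)
  -- One factor `w (n + 1) * ‖F n‖` of the quadratic term in `F` tends to zero; the remaining `p n *
  -- ‖F n‖` is summable.
  · have hb1 : ∀ᶠ n in atTop, ‖β n‖ ^ 2 * (w (n + 1) * ‖F n‖) ≤ 1 := by
      have := (hβ1.norm.pow 2).mul hF0
      rw [mul_zero] at this
      filter_upwards [this.eventually (gt_mem_nhds one_pos)] with n hn using hn.le
    have hb2 : ∀ᶠ n in atTop, ‖α n * a n‖ ^ 2 ≤ 2 := by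
      have := hA1.norm.pow 2
      filter_upwards [this.eventually (gt_mem_nhds (by norm_num : ‖(1 : ℂ)‖ ^ 2 < 2))] with n hn
      exact hn.le
    refine Summable.of_norm_bounded_eventually_nat ((hFs.mul_left 2).add (hS2.mul_left 4)) ?_
    filter_upwards [hb1, hb2] with n h1 h2
    have hpw0 : 0 ≤ p n * w (n + 1) := mul_nonneg (hp0 n).le (hw _).le
    rw [Real.norm_of_nonneg (mul_nonneg hpw0 (by positivity))]
    have h3 : ‖β n * F n - S (n + 1) * (α n * a n)‖ ^ 2 ≤
        2 * (‖β n‖ ^ 2 * ‖F n‖ ^ 2) + 2 * (‖S (n + 1)‖ ^ 2 * ‖α n * a n‖ ^ 2) := by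
      have := norm_sub_le (β n * F n) (S (n + 1) * (α n * a n))
      rw [norm_mul (β n), norm_mul (S (n + 1))] at this
      have h4 := pow_le_pow_left₀ (norm_nonneg _) this 2
      nlinarith [sq_nonneg (‖β n‖ * ‖F n‖ - ‖S (n + 1)‖ * ‖α n * a n‖)]
    refine (mul_le_mul_of_nonneg_left h3 hpw0).trans ?_
    have h5 := mul_le_mul_of_nonneg_left h1 (mul_nonneg (hp0 n).le (norm_nonneg (F n)))
    have h6 := mul_le_mul_of_nonneg_left h2
      (mul_nonneg hpw0 (sq_nonneg ‖S (n + 1)‖))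
    simp only [hp] at h5 h6 ⊢
    linarith
  · filter_upwards [hα, hβ, haF] with n h1 h2 ⟨h3, h4⟩
    have e1 : α (n + 1) * a (n + 1) = (1 - x n) * (α n * a n) + p n * (β n * F n) := by
      have := hα0 (n + 1)
      have e : α (n + 1) * a n = (1 - x n) * (α n * a n) := by rw [h1]; ring
      rw [h3, mul_add, e]
      field_simp
    have e2 : β (n + 1) * F (n + 1) =
        (1 + x n) * (β n * F n) - S (n + 1) ^ 2 * p n * (α n * a n) := by
      have := hβ0 (n + 1)
      have e : β (n + 1) * F n = (1 + x n) * (β n * F n) := by rw [h2]; ring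
      rw [h4, mul_sub, e]
      field_simp
    constructor
    · rw [e1]
      simp only [hx]
      ring
    · rw [e2, e1]
      simp only [hx]
      ring

/-- Reduction of order: from a principal solution `a` tending to `1` one gets a solution `b`
with Casoratian `w (n + 1) - w n` and `b ~ w`. -/
theorem exists_nonprincipal_asymptotics {w : ℕ → ℝ} {s a D : ℕ → ℂ}
    (hw : ∀ n, 0 < w n) (hmono : StrictMono w) (htop : Tendsto w atTop atTop)
    (ha : Tendsto a atTop (𝓝 1))
    (heq : ∀ᶠ n in atTop, a (n + 1) - a n = ((w (n + 1) - w n : ℝ) : ℂ) * D n ∧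
      D (n + 1) - D n = s (n + 1) * a (n + 1)) :
    ∃ b E : ℕ → ℂ, Tendsto (fun n => b n / (w n : ℂ)) atTop (𝓝 1) ∧
      (∀ᶠ n in atTop, b (n + 1) - b n = ((w (n + 1) - w n : ℝ) : ℂ) * E n ∧
        E (n + 1) - E n = s (n + 1) * b (n + 1)) ∧
      ∀ᶠ n in atTop, b (n + 1) * a n - a (n + 1) * b n = ((w (n + 1) - w n : ℝ) : ℂ) := by
  set p : ℕ → ℝ := fun n => w (n + 1) - w n with hp
  have hp0 : ∀ n, 0 < p n := fun n => sub_pos.2 (hmono n.lt_succ_self)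
  -- The Casoratian equation for `b = a c` is `Δc = p / (a n * a (n + 1))`. The finitely many terms
  -- with a zero denominator count as `0`, which does not affect the asymptotics.
  set c : ℕ → ℂ := fun n => ∑ k ∈ Finset.range n, (p k : ℂ) / (a k * a (k + 1)) with hc
  have hcs : ∀ n, c (n + 1) = c n + (p n : ℂ) / (a n * a (n + 1)) := fun n =>
    Finset.sum_range_succ _ _
  have ha' : Tendsto (fun n => a (n + 1)) atTop (𝓝 1) := (tendsto_add_atTop_iff_nat 1).2 ha
  have hne : ∀ᶠ n in atTop, a n ≠ 0 := ha.eventually_ne one_ne_zero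
  have hne' : ∀ᶠ n in atTop, a (n + 1) ≠ 0 := ha'.eventually_ne one_ne_zero
  have hsum : ∀ n, ∑ k ∈ Finset.range n, p k = w n - w 0 := fun n => Finset.sum_range_sub w n
  have hcw : Tendsto (fun n => c n / (w n : ℂ)) atTop (𝓝 1) := by
    -- Stolz–Cesàro: the increments of `c` and `w` are asymptotic and `w → ∞`, hence `c / w → 1`.
    have h1 : (fun n => (p n : ℂ) / (a n * a (n + 1)) - (p n : ℂ)) =o[atTop] p := by
      refine isLittleO_of_eventuallyEq_mul (φ := fun n => 1 / (a n * a (n + 1)) - 1)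
        (Eventually.of_forall fun n => by ring) ?_
      simpa using ((ha.mul ha').inv₀ (by simp)).sub_const 1
    have h2 := h1.sum_range (fun n => (hp0 n).le)
      (by simp only [hsum]; exact tendsto_atTop_add_const_right _ _ htop)
    have h3 : (fun n => c n - ((w n - w 0 : ℝ) : ℂ)) =o[atTop] w := by
      refine (h2.congr (fun n => ?_) hsum).trans_isBigO
        (isBigO_of_le _ fun n => ?_)
      · rw [Finset.sum_sub_distrib, ← Complex.ofReal_sum, hsum]
      · rw [Real.norm_of_nonneg (hw n).le, Real.norm_of_nonneg
          (sub_nonneg.2 (hmono.monotone (Nat.zero_le n)))]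
        linarith [hw 0]
    have h4 : Tendsto (fun n => (c n - ((w n - w 0 : ℝ) : ℂ)) / (w n : ℂ)) atTop (𝓝 0) := by
      rw [tendsto_zero_iff_norm_tendsto_zero]
      simpa [norm_div] using h3.norm_left.norm_right.tendsto_div_nhds_zero
    have h5 : Tendsto (fun n => ((w 0 / w n : ℝ) : ℂ)) atTop (𝓝 0) := by
      have := (Complex.continuous_ofReal.tendsto 0).comp (htop.const_div_atTop (w 0))
      rw [Complex.ofReal_zero] at this
      exact this
    have h6 := (h4.sub h5).add_const 1
    rw [sub_zero, zero_add] at h6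
    refine h6.congr fun n => ?_
    have : (w n : ℂ) ≠ 0 := Complex.ofReal_ne_zero.2 (hw n).ne'
    push_cast
    field_simp
    ring
  refine ⟨fun n => a n * c n, fun n => D n * c n + 1 / a n, ?_, ?_, ?_⟩
  · simpa [mul_div_assoc] using ha.mul hcw
  · filter_upwards [heq, hne, hne'] with n ⟨h1, h2⟩ h3 h4
    have h5 := hcs n
    constructor
    · have : a (n + 1) * c (n + 1) - a n * c n =
          (a (n + 1) - a n) * c n + (p n : ℂ) / a n := by
        rw [h5]; field_simp; ring
      rw [this, h1]
      ring
    · have e1 : c n = c (n + 1) - (p n : ℂ) / (a n * a (n + 1)) := by rw [h5]; ring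
      have e2 : D n * ((p n : ℂ) / (a n * a (n + 1))) = 1 / a n - 1 / a (n + 1) := by
        have : D n * ((p n : ℂ) / (a n * a (n + 1))) = ((p n : ℂ) * D n) / (a n * a (n + 1)) := by
          ring
        rw [this, ← h1]
        field_simp
      rw [e1, mul_sub, e2]
      linear_combination c (n + 1) * h2
  · filter_upwards [hne, hne'] with n h3 h4
    rw [hcs n]
    field_simp
    ring

/-! ### Return to the original equation. -/

/-- A sequence that eventually satisfies the recursion agrees eventually with a solution. -/
theorem exists_solution_eventuallyEq {r : ℕ → ℝ} (hr : ∀ n, 0 < r n) {p y : ℕ → ℂ}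
    (hy : ∀ᶠ n in atTop, fdiff (fun k => (r k : ℂ) * fdiff y k) n = p (n + 1) * y (n + 1)) :
    ∃ y' : ℕ → ℂ, IsSolution r p y' ∧ y' =ᶠ[atTop] y := by
  obtain ⟨N, hN⟩ := eventually_atTop.1 hy
  clear hy
  induction N generalizing y with
  | zero => exact ⟨y, fun n => hN n (Nat.zero_le n), EventuallyEq.rfl⟩
  | succ N ih =>
    have hrN : (r N : ℂ) ≠ 0 := Complex.ofReal_ne_zero.2 (hr N).ne'
    -- Since `r N ≠ 0`, the equation at index `N` can be solved backwards for the value at `N`.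
    set z : ℕ → ℂ := Function.update y N (y (N + 1) -
      ((r (N + 1) : ℂ) * fdiff y (N + 1) - p (N + 1) * y (N + 1)) / r N) with hz
    have hzy : ∀ n, N < n → z n = y n := fun n hn => Function.update_of_ne (by omega) _ _
    have hzN : z N = y (N + 1) -
      ((r (N + 1) : ℂ) * fdiff y (N + 1) - p (N + 1) * y (N + 1)) / r N :=
        Function.update_self _ _ _
    obtain ⟨y', h1, h2⟩ := ih (y := z) (fun n hn => by
      rcases hn.eq_or_lt with rfl | hlt
      · simp only [fdiff] at hzN ⊢
        rw [hzN, hzy _ (by omega), hzy _ (by omega)]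
        field_simp
        ring
      · have := hN n hlt
        simp only [fdiff] at this ⊢
        rw [hzy _ (by omega), hzy _ (by omega), hzy _ hlt]
        exact this)
    exact ⟨y', h1, h2.trans (eventually_atTop.2 ⟨N + 1, fun n hn => hzy n hn⟩)⟩

/-- Substituting `y = u f`, where `u` solves the unperturbed equation. -/
theorem fdiff_mul_fdiff_mul {r u : ℕ → ℝ} (hr : ∀ n, 0 < r n) (hu : ∀ n, 0 < u n)
    {q σ f D : ℕ → ℂ} (hsol : IsSolution r q fun n => (u n : ℂ)) {n : ℕ}
    (h1 : f (n + 1) - f n = ((1 / (r n * u n * u (n + 1)) : ℝ) : ℂ) * D n)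
    (h1' : f (n + 2) - f (n + 1) =
      ((1 / (r (n + 1) * u (n + 1) * u (n + 2)) : ℝ) : ℂ) * D (n + 1))
    (h2 : D (n + 1) - D n = σ (n + 1) * (u (n + 1) : ℂ) ^ 2 * f (n + 1)) :
    fdiff (fun k => (r k : ℂ) * fdiff (fun k => (u k : ℂ) * f k) k) n =
      (q (n + 1) + σ (n + 1)) * ((u (n + 1) : ℂ) * f (n + 1)) := by
  have hs := hsol n
  simp only [fdiff] at hs ⊢
  have hr0 : (r n : ℂ) ≠ 0 := Complex.ofReal_ne_zero.2 (hr n).ne'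
  have hr1 : (r (n + 1) : ℂ) ≠ 0 := Complex.ofReal_ne_zero.2 (hr _).ne'
  have hu0 : (u n : ℂ) ≠ 0 := Complex.ofReal_ne_zero.2 (hu n).ne'
  have hu1 : (u (n + 1) : ℂ) ≠ 0 := Complex.ofReal_ne_zero.2 (hu _).ne'
  have hu2 : (u (n + 2) : ℂ) ≠ 0 := Complex.ofReal_ne_zero.2 (hu _).ne'
  -- Both differences of `u f` are expanded around `f (n + 1)`, so that `D n` and `D (n + 1)` share
  -- the denominator `u (n + 1)`.
  have k1 : (r n : ℂ) * u n * (f (n + 1) - f n) = D n / u (n + 1) := by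
    rw [h1]; push_cast; field_simp
  have k2 : (r (n + 1) : ℂ) * u (n + 2) * (f (n + 2) - f (n + 1)) = D (n + 1) / u (n + 1) := by
    rw [h1']; push_cast; field_simp
  have k3 : D (n + 1) / u (n + 1) - D n / u (n + 1) = σ (n + 1) * u (n + 1) * f (n + 1) := by
    rw [← sub_div, h2]; field_simp
  have e : n + 1 + 1 = n + 2 := rfl
  rw [e] at hs ⊢
  linear_combination f (n + 1) * hs + k2 - k1 + k3

variable {r q : ℕ → ℝ} {σ : ℕ → ℂ} {u v : ℕ → ℝ}

namespace IsPrincipalPair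

theorem ratio_pos (huv : IsPrincipalPair r q u v) (n : ℕ) : 0 < v n / u n :=
  div_pos (huv.v_pos n) (huv.u_pos n)

/-- This is the Casoratian identity divided by `r n * u n * u (n + 1)`; it lets `w = v / u` carry
all the coefficients. -/
theorem ratio_sub (huv : IsPrincipalPair r q u v) (hr : ∀ n, 0 < r n) (n : ℕ) :
    v (n + 1) / u (n + 1) - v n / u n = 1 / (r n * u n * u (n + 1)) := by
  have h := huv.casoratian n
  have := (huv.u_pos n).ne'
  have := (huv.u_pos (n + 1)).ne'
  have := (hr n).ne'
  field_simp
  linear_combination h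

theorem ratio_strictMono (huv : IsPrincipalPair r q u v) (hr : ∀ n, 0 < r n) :
    StrictMono fun n => v n / u n := by
  refine strictMono_nat_of_lt_succ fun n => sub_pos.1 ?_
  rw [huv.ratio_sub hr n]
  have := huv.u_pos n
  have := huv.u_pos (n + 1)
  have := hr n
  positivity

theorem ratio_atTop (huv : IsPrincipalPair r q u v) :
    Tendsto (fun n => v n / u n) atTop atTop := by
  have h : Tendsto (fun n => u n / v n) atTop (𝓝[>] 0) :=
    tendsto_nhdsWithin_iff.2 ⟨huv.ratio_tendsto, Eventually.of_forall fun n =>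
      div_pos (huv.u_pos n) (huv.v_pos n)⟩
  exact h.inv_tendsto_nhdsGT_zero.congr fun n => by simp

end IsPrincipalPair

/-- The narrow problem is solvable if the weighted tails `C` of `∑ σ u²` tend to zero,
`∑ C / (r u v)` converges and `∑ |C|² / (r u v)` is finite. -/
theorem narrowSolvable_of_tails (hr : ∀ n, 0 < r n) (huv : IsPrincipalPair r q u v) {S : ℕ → ℂ}
    (hσ : ∀ n, σ n * (u n : ℂ) ^ 2 = S n - S (n + 1))
    (hS : Tendsto (fun n => v n / u n * ‖S n‖) atTop (𝓝 0))
    (hSw : SeriesConverges fun n =>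
      ((v (n + 1) / u (n + 1) - v n / u n : ℝ) : ℂ) * S (n + 1))
    (hS2 : Summable fun n =>
      (v (n + 1) / u (n + 1) - v n / u n) * (v (n + 1) / u (n + 1)) * ‖S (n + 1)‖ ^ 2) :
    NarrowSolvable r q σ u v := by
  have hmono := huv.ratio_strictMono hr
  obtain ⟨a, D, ha, hD, hD2, haD⟩ :=
    exists_principal_asymptotics (w := fun n => v n / u n) huv.ratio_pos hmono hS hSw hS2
  obtain ⟨b, E, hb, hbE, hab⟩ := exists_nonprincipal_asymptotics
    (w := fun n => v n / u n) (s := fun n => S n - S (n + 1))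
    huv.ratio_pos hmono huv.ratio_atTop ha haD
  have hsol : ∀ {f G : ℕ → ℂ}, (∀ᶠ n in atTop,
      f (n + 1) - f n = ((v (n + 1) / u (n + 1) - v n / u n : ℝ) : ℂ) * G n ∧
        G (n + 1) - G n = (S (n + 1) - S (n + 1 + 1)) * f (n + 1)) →
      ∃ y' : ℕ → ℂ, IsSolution r (fun n => (q n : ℂ) + σ n) y' ∧
        y' =ᶠ[atTop] fun n => (u n : ℂ) * f n := by
    intro f G hf
    refine exists_solution_eventuallyEq hr ?_
    filter_upwards [hf, (tendsto_add_atTop_nat 1).eventually hf] with n h h'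
    refine fdiff_mul_fdiff_mul (D := G) hr huv.u_pos huv.fss.1 ?_ ?_ ?_
    · rw [h.1, huv.ratio_sub hr]
    · rw [h'.1, huv.ratio_sub hr]
    · rw [h.2, hσ]
  obtain ⟨u', hu', hua⟩ := hsol haD
  obtain ⟨v', hv', hvb⟩ := hsol hbE
  have hu0 : ∀ n, (u n : ℂ) ≠ 0 := fun n => Complex.ofReal_ne_zero.2 (huv.u_pos n).ne'
  have hv0 : ∀ n, (v n : ℂ) ≠ 0 := fun n => Complex.ofReal_ne_zero.2 (huv.v_pos n).ne'
  have hr0 : ∀ n, (r n : ℂ) ≠ 0 := fun n => Complex.ofReal_ne_zero.2 (hr n).ne'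
  have huu : ∀ᶠ n in atTop, u' n / (u n : ℂ) = a n := by
    filter_upwards [hua] with n hn
    rw [hn, mul_div_cancel_left₀ _ (hu0 n)]
  have hvv : ∀ᶠ n in atTop, v' n / (v n : ℂ) = b n / ((v n / u n : ℝ) : ℂ) := by
    filter_upwards [hvb] with n hn
    have := hu0 n
    have := hv0 n
    rw [hn]
    push_cast
    field_simp
  have hua' := (tendsto_add_atTop_nat 1).eventually hua
  have hvb' := (tendsto_add_atTop_nat 1).eventually hvb
  have ha0 : ∀ᶠ n in atTop, a n ≠ 0 := ha.eventually_ne one_ne_zero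
  have hb0 : ∀ᶠ n in atTop, b n ≠ 0 := by
    filter_upwards [hb.eventually_ne one_ne_zero] with n hn h
    simp [h] at hn
  have hDa : Tendsto (fun n => ((v n / u n : ℝ) : ℂ) * D n / a n) atTop (𝓝 0) := by
    have := hD.div ha one_ne_zero
    rw [zero_div] at this
    exact this
  refine ⟨u', v', ⟨⟨hu', hv', ?_⟩, ha.congr' (huu.mono fun n h => h.symm),
    hb.congr' (hvv.mono fun n h => h.symm), ?_, ?_⟩, ?_⟩
  · rw [LinearIndependent.pair_iff]
    intro c d hcd
    obtain ⟨n, h1, h2, h1', h2', h3⟩ :=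
      (hua.and (hvb.and (hua'.and (hvb'.and hab)))).exists
    have k0 := congrFun hcd n
    have k1 := congrFun hcd (n + 1)
    simp only [Pi.add_apply, Pi.smul_apply, smul_eq_mul, Pi.zero_apply, h1, h2, h1', h2'] at k0 k1
    have k0' : c * a n + d * b n = 0 := by
      apply mul_left_cancel₀ (hu0 n)
      linear_combination k0
    have k1' : c * a (n + 1) + d * b (n + 1) = 0 := by
      apply mul_left_cancel₀ (hu0 (n + 1))
      linear_combination k1
    have hp : ((v (n + 1) / u (n + 1) - v n / u n : ℝ) : ℂ) ≠ 0 :=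
      Complex.ofReal_ne_zero.2 (sub_pos.2 (hmono n.lt_succ_self)).ne'
    constructor
    · apply mul_right_cancel₀ hp
      rw [← h3]
      linear_combination b (n + 1) * k0' - b n * k1'
    · apply mul_right_cancel₀ hp
      rw [← h3]
      linear_combination a n * k1' - a (n + 1) * k0'
  · refine isLittleO_of_eventuallyEq_mul ?_ hDa
    filter_upwards [hua, hua', haD, ha0] with n h1 h2 h3 h4
    have e : a (n + 1) = a n + ((v (n + 1) / u (n + 1) - v n / u n : ℝ) : ℂ) * D n := by
      rw [← h3.1]; ring
    rw [h1, h2, e, huv.ratio_sub hr]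
    have := hu0 n
    have := hu0 (n + 1)
    have := hv0 n
    have := hr0 n
    push_cast
    field_simp
    ring
  -- The Casoratian gives `b (n + 1) / b n = a (n + 1) / a n + Δw / (a n * b n)`, so no estimate of
  -- `E` is needed.
  · refine isLittleO_of_eventuallyEq_mul (φ := fun n => ((v n / u n : ℝ) : ℂ) * D n / a n +
      (1 / (a n * (b n / ((v n / u n : ℝ) : ℂ))) - 1)) ?_ ?_
    · filter_upwards [hvb, hvb', haD, ha0, hb0, hab] with n h1 h2 h3 h4 h5 h6
      have e : a (n + 1) = a n + ((v (n + 1) / u (n + 1) - v n / u n : ℝ) : ℂ) * D n := by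
        rw [← h3.1]; ring
      have e2 : b (n + 1) = (a (n + 1) * b n +
          ((v (n + 1) / u (n + 1) - v n / u n : ℝ) : ℂ)) / a n := by
        rw [eq_div_iff h4]
        linear_combination h6
      have e3 : v (n + 1) = u (n + 1) * (v n / u n + 1 / (r n * u n * u (n + 1))) := by
        rw [← huv.ratio_sub hr n, add_sub_cancel, mul_div_cancel₀ _ (huv.u_pos _).ne']
      rw [h1, h2, e2, e, huv.ratio_sub hr, e3]
      have := hu0 n
      have := hu0 (n + 1)
      have := hv0 n
      have := hr0 n
      push_cast
      field_simp
      ring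
    · have := hDa.add (((ha.mul hb).inv₀ (by simp)).sub_const 1)
      simpa using this
  -- Here `Δ(u' / u) = Δw · D` eventually, and `r n * u n * v (n + 1) * Δw = w (n + 1)`.
  · refine (summable_congr_atTop ?_).1 hD2
    filter_upwards [huu, (tendsto_add_atTop_nat 1).eventually huu, haD] with n h1 h2 h3
    rw [h1, h2, h3.1, huv.ratio_sub hr, norm_mul, Complex.norm_real, mul_pow, Real.norm_eq_abs,
      sq_abs]
    have := (huv.u_pos n).ne'
    have := (huv.u_pos (n + 1)).ne'
    have := (hr n).ne'
    field_simp

/-! ### Conditionally convergent series and Abel summation. -/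

theorem SeriesConverges.tendsto_tailSum {a : ℕ → ℂ} (ha : SeriesConverges a) :
    Tendsto (tailSum a) atTop (𝓝 0) ∧ ∀ n, tailSum a n - tailSum a (n + 1) = a n := by
  obtain ⟨l, hl⟩ := ha
  have h : ∀ m, tailSum a m = l - ∑ k ∈ Finset.range m, a k := fun m => by
    refine Tendsto.limUnder_eq ((hl.sub_const _).congr' ?_)
    filter_upwards [eventually_ge_atTop m] with N hN
    rw [Finset.sum_Ico_eq_sub _ hN]
  constructor
  · simpa only [funext h, sub_self] using hl.const_sub l
  · intro n
    rw [h, h, Finset.sum_range_succ]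
    ring

/-- Used to identify the tails in `seqC` with the sequence constructed by Abel summation. -/
theorem tailSum_eq_of_telescoping {a S : ℕ → ℂ} (haS : ∀ n, a n = S n - S (n + 1))
    (hS : Tendsto S atTop (𝓝 0)) : tailSum a = S := by
  funext m
  refine Tendsto.limUnder_eq ?_
  have := hS.const_sub (S m)
  rw [sub_zero] at this
  refine this.congr' ?_
  filter_upwards [eventually_ge_atTop m] with N hN
  have h := Finset.sum_Ico_sub S hN
  rw [← neg_inj, neg_sub, ← h, ← Finset.sum_neg_distrib]
  exact Finset.sum_congr rfl fun k _ => by rw [haS, neg_sub]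

theorem SeriesConverges.of_telescoping {E : Type*} [NormedAddCommGroup E] {a G : ℕ → E} {l : E}
    (h : ∀ n, a n = G n - G (n + 1)) (hG : Tendsto G atTop (𝓝 l)) : SeriesConverges a := by
  refine ⟨_, (hG.const_sub (G 0)).congr fun N => ?_⟩
  rw [← Finset.sum_range_sub' G N]
  exact Finset.sum_congr rfl fun n _ => (h n).symm

theorem SeriesConverges.exists_sum_le {a : ℕ → ℝ} (ha : SeriesConverges a) :
    ∃ B, ∀ n, ∑ i ∈ Finset.range n, a i ≤ B := by
  obtain ⟨l, hl⟩ := ha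
  obtain ⟨B, hB⟩ := hl.bddAbove_range
  exact ⟨B, fun n => hB ⟨n, rfl⟩⟩

/-- Abel summation: dividing the terms of a convergent series with tails `J` by an increasing
weight `w` gives a convergent series with tails `S`, and `w |S|` is at most `2 sup |J|`. -/
theorem exists_weighted_tails {w : ℕ → ℝ} {J : ℕ → ℂ} (hw : ∀ n, 0 < w n) (hmono : Monotone w)
    (hJ : Tendsto J atTop (𝓝 0)) :
    ∃ S : ℕ → ℂ, (∀ n, S n - S (n + 1) = (J n - J (n + 1)) / w n) ∧
      ∀ n B, (∀ k, n ≤ k → ‖J k‖ ≤ B) → w n * ‖S n‖ ≤ 2 * B := by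
  set g : ℕ → ℝ := fun k => 1 / w k - 1 / w (k + 1) with hg
  have hg0 : ∀ k, 0 ≤ g k := fun k =>
    sub_nonneg.2 (one_div_le_one_div_of_le (hw k) (hmono k.le_succ))
  have hgs : Summable g := by
    refine summable_of_le_add_telescoping (g := fun _ => 0) (h := fun k => -(1 / w k))
      (B := 0) (H := 0) hg0 (fun n => ?_) (fun n => by simp) (fun n => ?_)
    · simp only [hg]
      apply le_of_eq
      ring
    · have := hw n
      simp only [Left.neg_nonpos_iff]
      positivity
  have hgt : ∀ n, tsumTail g n ≤ 1 / w n := fun n => by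
    refine Real.tsum_le_of_sum_range_le (fun k => hg0 _) fun m => ?_
    have := Finset.sum_range_sub' (fun k => 1 / w (k + n)) m
    simp only [zero_add, add_right_comm _ 1 n] at this
    simp only [hg]
    rw [this]
    have := hw (m + n)
    simp only [tsub_le_iff_right, le_add_iff_nonneg_right]
    positivity
  obtain ⟨M, hM⟩ := hJ.norm.bddAbove_range
  have hterm : ∀ k B, ‖J (k + 1)‖ ≤ B → ‖J (k + 1) * (g k : ℂ)‖ ≤ B * g k := fun k B h => by
    rw [norm_mul, Complex.norm_real, Real.norm_of_nonneg (hg0 k)]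
    exact mul_le_mul_of_nonneg_right h (hg0 k)
  have hsum : Summable fun k => J (k + 1) * (g k : ℂ) :=
    Summable.of_norm_bounded (hgs.mul_left M) fun k => hterm k M (hM ⟨k + 1, rfl⟩)
  have hw0 : ∀ n, (w n : ℂ) ≠ 0 := fun n => Complex.ofReal_ne_zero.2 (hw n).ne'
  -- Both pieces are at most `B / w n`, because the tail of `g` telescopes; this is the source of
  -- the factor `2`.
  refine ⟨fun n => J n / w n - tsumTail (fun k => J (k + 1) * (g k : ℂ)) n, fun n => ?_,
    fun n B hB => ?_⟩
  · have h := tsumTail_eq_add_succ hsum n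
    beta_reduce
    rw [h]
    simp only [hg]
    push_cast
    have := hw0 n
    have := hw0 (n + 1)
    field_simp
    ring
  · have h1 : ‖tsumTail (fun k => J (k + 1) * (g k : ℂ)) n‖ ≤ B * (1 / w n) :=
      (norm_tsumTail_le (hgs.mul_left B) fun k hk => hterm k B (hB _ (by omega))).trans <| by
        rw [tsumTail_const_mul]
        exact mul_le_mul_of_nonneg_left (hgt n) ((norm_nonneg _).trans (hB n le_rfl))
    have h2 : ‖J n / (w n : ℂ)‖ ≤ B * (1 / w n) := by
      rw [norm_div, Complex.norm_real, Real.norm_of_nonneg (hw n).le, div_eq_mul_one_div]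
      exact mul_le_mul_of_nonneg_right (hB n le_rfl) (one_div_pos.2 (hw n)).le
    calc _ ≤ w n * (B * (1 / w n) + B * (1 / w n)) :=
          mul_le_mul_of_nonneg_left ((norm_sub_le _ _).trans (add_le_add h2 h1)) (hw n).le
      _ = 2 * B := by
          have := (hw n).ne'
          field_simp
          ring

/-! ### Quadratic inequalities with telescoping terms. -/

/-- If `J = C + G` with `C = w S` and `G (n) - G (n + 1) = S (n + 1) Δw`, then `∑ w |S|² Δw` is
controlled by `∑ |J| |C| Δw / w` up to a telescoping term. -/
theorem weight_mul_sq_le {p w : ℝ} {S J G G' : ℂ} (hp : 0 ≤ p) (hpw : p ≤ w) (hw : 0 < w)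
    (hJ : J = w * S + G') (hG : G - G' = p * S) :
    p * w * ‖S‖ ^ 2 ≤ 2 * (p / w * (‖J‖ * ‖(w : ℂ) * S‖)) + (‖G'‖ ^ 2 - ‖G‖ ^ 2) := by
  have h1 : (J * (starRingEnd ℂ) S).re ≤ ‖J‖ * ‖S‖ := by
    refine (Complex.re_le_norm _).trans ?_
    rw [norm_mul, RCLike.norm_conj]
  have e : p / w * (‖J‖ * ‖(w : ℂ) * S‖) = p * (‖J‖ * ‖S‖) := by
    rw [norm_mul, Complex.norm_real, Real.norm_of_nonneg hw.le]
    field_simp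
  -- Expanding `|G|²` with `G' = J - w S` gives `(2 p w - p²) |S|² = 2 p Re (J conj S) + |G'|² -
  -- |G|²`, and `p ≤ w` makes the left side at least `p w |S|²`.
  have hGG : G = G' + p * S := by rw [← hG]; ring
  have h2 := mul_le_mul_of_nonneg_left h1 hp
  have h3 : p * p * ‖S‖ ^ 2 ≤ p * w * ‖S‖ ^ 2 :=
    mul_le_mul_of_nonneg_right (mul_le_mul_of_nonneg_left hpw hp) (sq_nonneg _)
  rw [e]
  simp only [Complex.sq_norm, Complex.normSq_apply, hGG, hJ] at h1 h2 h3 ⊢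
  simp only [Complex.mul_re, Complex.add_re, Complex.add_im, Complex.mul_im, Complex.ofReal_re,
    Complex.ofReal_im, Complex.conj_re, Complex.conj_im] at h1 h2 h3 ⊢
  linarith

/-- The analogous bound in terms of `Re (s conj (w S)) w`, where `s = S - S'`. -/
theorem weight_mul_sq_le_of_re {w w' : ℝ} {S S' : ℂ} (hw : 0 < w) (hww : w ≤ w') :
    (w' - w) * w' * ‖S'‖ ^ 2 ≤
      2 * (((S - S') * (starRingEnd ℂ) (w * S)).re * w) +
        (‖(w' : ℂ) * S'‖ ^ 2 - ‖(w : ℂ) * S‖ ^ 2) := by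
  -- The right side equals `w² |S - S'|² + (w'² - w²) |S'|²`; `h1` and `h2` are the parts discarded.
  have h1 : 0 ≤ (w' - w) * w * ‖S'‖ ^ 2 :=
    mul_nonneg (mul_nonneg (sub_nonneg.2 hww) hw.le) (sq_nonneg _)
  have h2 : 0 ≤ w ^ 2 * ‖S - S'‖ ^ 2 := by positivity
  simp only [Complex.sq_norm, Complex.normSq_apply, Complex.mul_re, Complex.sub_re, Complex.sub_im,
    Complex.mul_im, Complex.ofReal_re, Complex.ofReal_im, Complex.conj_re, Complex.conj_im]
    at h1 h2 ⊢
  linarith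

end HartmanWintner

end

/-! ### Verification of the sufficient conditions. -/

open HartmanWintner in
theorem corollary1p3p1 (r q : ℕ → ℝ) (σ : ℕ → ℂ) (u v : ℕ → ℝ)
    (hr : ∀ n, 0 < r n)
    (huv : HartmanWintner.IsPrincipalPair r q u v)
    (hJ : HartmanWintner.SeriesConverges (HartmanWintner.termJ σ u v))
    (h :
      ((Summable fun n =>
            ‖HartmanWintner.tailJ σ u v (n + 1) * HartmanWintner.seqC σ u v (n + 1)‖ /
              (r n * u n * v (n + 1))) ∨
          (Summable fun n =>
            HartmanWintner.supJ σ u v (n + 1) * ‖HartmanWintner.seqC σ u v (n + 1)‖ /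
              (r n * v (n + 1) * u n)) ∨
          (Summable fun n =>
            ‖HartmanWintner.tailJ σ u v (n + 1)‖ ^ 2 / (r n * u n * v (n + 1)))) ∨
        HartmanWintner.SeriesConverges (HartmanWintner.termP σ u v) ∨
        (Summable fun n => ‖σ n‖ * HartmanWintner.supJ σ u v n * u n * v n) ∨
        (Summable fun n => ‖HartmanWintner.termJ σ u v n‖)) :
    HartmanWintner.NarrowSolvable r q σ u v := by
  obtain ⟨hJ0, hJs⟩ := hJ.tendsto_tailSum
  have hu := huv.u_pos
  have hv := huv.v_pos
  have hmono := huv.ratio_strictMono hr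
  have hu0 : ∀ n, (u n : ℂ) ≠ 0 := fun n => Complex.ofReal_ne_zero.2 (hu n).ne'
  have hv0 : ∀ n, (v n : ℂ) ≠ 0 := fun n => Complex.ofReal_ne_zero.2 (hv n).ne'
  obtain ⟨S, hS, hSB⟩ := exists_weighted_tails huv.ratio_pos hmono.monotone hJ0
  have hσ : ∀ n, σ n * (u n : ℂ) ^ 2 = S n - S (n + 1) := fun n => by
    rw [hS, hJs, termJ]
    have := hu0 n
    have := hv0 n
    push_cast
    field_simp
  have hwS : Tendsto (fun n => v n / u n * ‖S n‖) atTop (𝓝 0) := by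
    rw [Metric.tendsto_atTop]
    intro ε hε
    obtain ⟨N, hN⟩ := (Metric.tendsto_atTop.1 hJ0) (ε / 3) (by positivity)
    refine ⟨N, fun n hn => ?_⟩
    rw [dist_zero_right, Real.norm_of_nonneg (mul_nonneg (huv.ratio_pos n).le (norm_nonneg _))]
    have := hSB n (ε / 3) fun k hk => by simpa using (hN k (hn.trans hk)).le
    linarith
  have hS0 : Tendsto S atTop (𝓝 0) := by
    rw [tendsto_zero_iff_norm_tendsto_zero]
    have := hwS.const_mul (v 0 / u 0)⁻¹
    rw [mul_zero] at this
    refine squeeze_zero (fun n => norm_nonneg _) (fun n => ?_) this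
    rw [← mul_assoc, inv_mul_eq_div]
    exact le_mul_of_one_le_left (norm_nonneg _)
      ((one_le_div (huv.ratio_pos 0)).2 (hmono.monotone (Nat.zero_le n)))
  have hC : ∀ n, seqC σ u v n = ((v n / u n : ℝ) : ℂ) * S n := fun n => by
    rw [seqC, tailSum_eq_of_telescoping hσ hS0]
  have hCn : ∀ n, ‖seqC σ u v n‖ = v n / u n * ‖S n‖ := fun n => by
    rw [hC, norm_mul, Complex.norm_real, Real.norm_of_nonneg (huv.ratio_pos n).le]
  have hC0 : Tendsto (seqC σ u v) atTop (𝓝 0) := by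
    rw [tendsto_zero_iff_norm_tendsto_zero]
    exact hwS.congr fun n => (hCn n).symm
  have hp0 : ∀ n, 0 < v (n + 1) / u (n + 1) - v n / u n := fun n =>
    sub_pos.2 (hmono n.lt_succ_self)
  have hpw : ∀ n, v (n + 1) / u (n + 1) - v n / u n ≤ v (n + 1) / u (n + 1) := fun n => by
    linarith [huv.ratio_pos n]
  -- By partial summation `G` is the tail of `∑ S (n + 1) Δw`, which therefore converges.
  set G : ℕ → ℂ := fun n => tailJ σ u v n - seqC σ u v n with hG
  have hG0 : Tendsto G atTop (𝓝 0) := by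
    have := hJ0.sub hC0
    rw [sub_zero] at this
    exact this
  have hGs : ∀ n, G n - G (n + 1) =
      ((v (n + 1) / u (n + 1) - v n / u n : ℝ) : ℂ) * S (n + 1) := fun n => by
    have h1 : tailJ σ u v n - tailJ σ u v (n + 1) = ((v n / u n : ℝ) : ℂ) * (S n - S (n + 1)) := by
      rw [hS]
      exact (mul_div_cancel₀ _ (Complex.ofReal_ne_zero.2 (huv.ratio_pos n).ne')).symm
    simp only [hG, hC]
    push_cast at h1 ⊢
    linear_combination h1
  have hbdd : ∀ n, BddAbove (Set.range fun k => ‖tailJ σ u v (n + k)‖) := fun n => by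
    obtain ⟨B, hB⟩ := hJ0.norm.bddAbove_range
    exact ⟨B, by rintro _ ⟨k, rfl⟩; exact hB ⟨n + k, rfl⟩⟩
  have hJA : ∀ n k, n ≤ k → ‖tailJ σ u v k‖ ≤ supJ σ u v n := fun n k hk => by
    obtain ⟨m, rfl⟩ := Nat.exists_eq_add_of_le hk
    exact le_ciSup (hbdd n) m
  have hε : ∀ n, 1 / (r n * u n * v (n + 1)) =
      (v (n + 1) / u (n + 1) - v n / u n) / (v (n + 1) / u (n + 1)) := fun n => by
    rw [huv.ratio_sub hr]
    have := (hu n).ne'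
    have := (hu (n + 1)).ne'
    have := (hv (n + 1)).ne'
    have := (hr n).ne'
    field_simp
  have hden : ∀ n, 0 < r n * u n * v (n + 1) := fun n =>
    mul_pos (mul_pos (hr n) (hu n)) (hv _)
  obtain ⟨B, hB⟩ := (hG0.norm.pow 2).bddAbove_range
  have hGB : ∀ n, ‖G n‖ ^ 2 ≤ B := fun n => hB ⟨n, rfl⟩
  have hnn : ∀ n, 0 ≤ (v (n + 1) / u (n + 1) - v n / u n) * (v (n + 1) / u (n + 1)) *
      ‖S (n + 1)‖ ^ 2 := fun n =>
    mul_nonneg (mul_nonneg (hp0 n).le (huv.ratio_pos _).le) (sq_nonneg _)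
  have hkey : ∀ n, (v (n + 1) / u (n + 1) - v n / u n) * (v (n + 1) / u (n + 1)) *
      ‖S (n + 1)‖ ^ 2 ≤ 2 * (‖tailJ σ u v (n + 1) * seqC σ u v (n + 1)‖ /
        (r n * u n * v (n + 1))) + (‖G (n + 1)‖ ^ 2 - ‖G n‖ ^ 2) := fun n => by
    have := weight_mul_sq_le (hp0 n).le (hpw n) (huv.ratio_pos (n + 1))
      (J := tailJ σ u v (n + 1)) (by simp only [hG, hC]; ring) (hGs n)
    rwa [← hε, ← hC, ← norm_mul, one_div_mul_eq_div] at this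
  refine narrowSolvable_of_tails hr huv hσ hwS (.of_telescoping (fun n => (hGs n).symm) hG0) ?_
  have of_JC : (Summable fun n => ‖tailJ σ u v (n + 1) * seqC σ u v (n + 1)‖ /
      (r n * u n * v (n + 1))) → Summable fun n =>
      (v (n + 1) / u (n + 1) - v n / u n) * (v (n + 1) / u (n + 1)) * ‖S (n + 1)‖ ^ 2 :=
    fun hs => summable_of_le_add_telescoping hnn hkey
      (fun n => (hs.mul_left 2).sum_le_tsum _ fun i _ =>
        mul_nonneg two_pos.le (div_nonneg (norm_nonneg _) (hden i).le)) hGB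
  have of_P : SeriesConverges (termP σ u v) → Summable fun n =>
      (v (n + 1) / u (n + 1) - v n / u n) * (v (n + 1) / u (n + 1)) * ‖S (n + 1)‖ ^ 2 := by
    intro hs
    obtain ⟨B₁, hB₁⟩ := hs.exists_sum_le
    obtain ⟨B₂, hB₂⟩ := (hC0.norm.pow 2).bddAbove_range
    refine summable_of_le_add_telescoping (g := fun n => 2 * termP σ u v n)
      (h := fun n => ‖seqC σ u v n‖ ^ 2) (B := 2 * B₁) (H := B₂) hnn (fun n => ?_) (fun n => ?_)
      (fun n => hB₂ ⟨n, rfl⟩)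
    · have := weight_mul_sq_le_of_re (S := S n) (S' := S (n + 1)) (huv.ratio_pos n)
        (hmono.monotone n.le_succ)
      rw [← hC, ← hC, ← hσ] at this
      have e : (σ n * (u n : ℂ) ^ 2 * (starRingEnd ℂ) (seqC σ u v n)).re * (v n / u n) =
          termP σ u v n := by
        rw [termP, mul_right_comm, ← Complex.ofReal_pow, Complex.re_mul_ofReal]
        have := (hu n).ne'
        field_simp
      rwa [e] at this
    · rw [← Finset.mul_sum]
      linarith [hB₁ n]
  have of_A : (Summable fun n => ‖σ n‖ * supJ σ u v n * u n * v n) → Summable fun n =>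
      (v (n + 1) / u (n + 1) - v n / u n) * (v (n + 1) / u (n + 1)) * ‖S (n + 1)‖ ^ 2 := by
    intro hs
    -- Since `|C| ≤ 2 A`, the series `P` converges absolutely.
    refine of_P ⟨_, (Summable.of_norm_bounded (hs.mul_left 2) fun n => ?_).hasSum.tendsto_sum_nat⟩
    have h1 : ‖seqC σ u v n‖ ≤ 2 * supJ σ u v n := by
      rw [hCn]
      exact hSB n _ (hJA n)
    have h2 : |(σ n * (starRingEnd ℂ) (seqC σ u v n)).re| ≤ ‖σ n‖ * (2 * supJ σ u v n) := by
      refine (Complex.abs_re_le_norm _).trans ?_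
      rw [norm_mul, RCLike.norm_conj]
      exact mul_le_mul_of_nonneg_left h1 (norm_nonneg _)
    rw [termP, norm_mul, norm_mul, Real.norm_of_nonneg (hu n).le, Real.norm_of_nonneg (hv n).le,
      Real.norm_eq_abs]
    calc _ ≤ ‖σ n‖ * (2 * supJ σ u v n) * u n * v n :=
          mul_le_mul_of_nonneg_right (mul_le_mul_of_nonneg_right h2 (hu n).le) (hv n).le
      _ = _ := by ring
  rcases h with (h | h | h) | h | h | h
  · exact of_JC h
  · refine of_JC (Summable.of_nonneg_of_le
      (fun n => div_nonneg (norm_nonneg _) (hden n).le) (fun n => ?_) h)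
    rw [norm_mul, mul_right_comm (r n) (v (n + 1)) (u n)]
    exact div_le_div_of_nonneg_right (mul_le_mul_of_nonneg_right (hJA _ _ le_rfl) (norm_nonneg _))
      (hden n).le
  -- By `|J| |C| ≤ |J|² + |C|² / 4`, half of the left side of `hkey` is absorbed; doubling the rest
  -- gives the constants `4` and `2`.
  · refine summable_of_le_add_telescoping (g := fun n => 4 * (‖tailJ σ u v (n + 1)‖ ^ 2 /
      (r n * u n * v (n + 1)))) (h := fun n => 2 * ‖G n‖ ^ 2) hnn (fun n => ?_)
      (fun n => (h.mul_left 4).sum_le_tsum _ fun i _ =>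
        mul_nonneg (by norm_num) (div_nonneg (sq_nonneg _) (hden i).le))
      (fun n => mul_le_mul_of_nonneg_left (hGB n) two_pos.le)
    have e : (v (n + 1) / u (n + 1) - v n / u n) * (v (n + 1) / u (n + 1)) * ‖S (n + 1)‖ ^ 2 =
        ‖seqC σ u v (n + 1)‖ ^ 2 / (r n * u n * v (n + 1)) := by
      rw [div_eq_mul_one_div (‖seqC σ u v (n + 1)‖ ^ 2), hε, hCn]
      have := (huv.ratio_pos (n + 1)).ne'
      field_simp
    have h1 := hkey n
    have h2 : ‖tailJ σ u v (n + 1) * seqC σ u v (n + 1)‖ / (r n * u n * v (n + 1)) ≤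
        (‖tailJ σ u v (n + 1)‖ ^ 2 + ‖seqC σ u v (n + 1)‖ ^ 2 / 4) /
          (r n * u n * v (n + 1)) := by
      refine div_le_div_of_nonneg_right ?_ (hden n).le
      rw [norm_mul]
      nlinarith [sq_nonneg (‖tailJ σ u v (n + 1)‖ - ‖seqC σ u v (n + 1)‖ / 2)]
    rw [add_div, div_right_comm, ← e] at h2
    linarith
  · exact of_P h
  · exact of_A h
  -- The supremum `A` is nonincreasing, so absolute convergence of `J` implies (III).
  · refine of_A (Summable.of_nonneg_of_le (fun n => ?_) (fun n => ?_)
      (h.mul_left (supJ σ u v 0)))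
    · exact mul_nonneg (mul_nonneg (mul_nonneg (norm_nonneg _)
        ((norm_nonneg _).trans (hJA n n le_rfl))) (hu n).le) (hv n).le
    · have h1 : supJ σ u v n ≤ supJ σ u v 0 := ciSup_le fun k => hJA 0 _ (Nat.zero_le _)
      rw [termJ, norm_mul, norm_mul, Complex.norm_real, Complex.norm_real,
        Real.norm_of_nonneg (hu n).le, Real.norm_of_nonneg (hv n).le]
      have h2 := mul_le_mul_of_nonneg_left h1
        (mul_nonneg (mul_nonneg (norm_nonneg (σ n)) (hu n).le) (hv n).le)
      linarith
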